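/- Let $\mathbb K\in\{\mathbb R,\mathbb C\}$, let $Q_+=\,]0,\infty[^d$, and let $\Omega\subset\mathbb R^d$ be a non-empty open set that is relatively compact in $Q_+$, i.e. $\overline{\Omega}$ is compact and $\overline{\Omega}\subset Q_+$. Let $\mathcal D'(\Omega)$ be the space of $\mathbb K$-valued distributions on $\Omega$ with its usual (strong) topology. A Hadamard operator on $\mathcal D'(\Omega)$ is a continuous linear operator $L:\mathcal D'(\Omega)\to\mathcal D'(\Omega)$ that admits all monomials as eigenvectors: for every $\alpha\in\mathbb N_0^d$ there is $m_\alpha\in\mathbb K$ with $L(x^\alpha)=m_\alpha x^\alpha$ (where $x^\alpha$ is regarded as a distribution on $\Omega$). Then every Hadamard operator $L$ on $\mathcal D'(\Omega)$ is an Euler operator, that is, there is a polynomial $P(X)=\sum_\alpha c_\alpha X^\alpha\in\mathbb K[X_1,\dots,X_d]$ such that $$L=P(\theta)=\sum_\alpha c_\alpha\,\theta^\alpha,\qquad \theta^\alpha=\theta_1^{\alpha_1}\cdots\theta_d^{\alpha_d},\qquad \theta_j=x_j\frac{\partial}{\partial x_j}.$$ -/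

import Mathlib

open TopologicalSpace MeasureTheory
open scoped Distributions LineDeriv

noncomputable section

namespace Hadamard

variable {d : ℕ}

/-- The open positive orthant `]0, ∞[^d` of `ℝ^d`. -/
def posOrthant (d : ℕ) : Set (Fin d → ℝ) := {x | ∀ j, 0 < x j}

/-- `A` is relatively compact in `B`: the closure of `A` is compact and contained in `B`. -/
def RelativelyCompactIn (A B : Set (Fin d → ℝ)) : Prop :=
  IsCompact (closure A) ∧ closure A ⊆ B

/-- The multiplication `φ ↦ x_j φ` of test functions on `Ω` by the `j`-th coordinate. -/
def coordMulTest (Ω : Opens (Fin d → ℝ)) (j : Fin d) : 𝓓(Ω, ℝ) →L[ℝ] 𝓓(Ω, ℝ) :=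
  TestFunction.limitCLM ℝ
    (fun φ => (⟨fun x => φ x * x j, φ.contDiff.mul (contDiff_apply ℝ ℝ j),
      φ.hasCompactSupport.mul_right,
      (closure_mono (Function.support_mul_subset_left _ _)).trans φ.tsupport_subset⟩ : 𝓓(Ω, ℝ)))
    (fun _ hK => TestFunction.ofSupportedInCLM ℝ hK ∘L
      ContDiffMapSupportedIn.bilinLeftCLM (ContinuousLinearMap.mul ℝ ℝ)
        (g := fun x : Fin d → ℝ => x j) (contDiff_apply ℝ ℝ j))
    (fun _ _ _ => rfl)

theorem coordMulTest_apply (Ω : Opens (Fin d → ℝ)) (j : Fin d) (φ : 𝓓(Ω, ℝ)) (x : Fin d → ℝ) :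
    coordMulTest Ω j φ x = φ x * x j := rfl

variable (𝕜 : Type*) [RCLike 𝕜] (Ω : Opens (Fin d → ℝ))

/-- The partial derivative `∂/∂x_j` on distributions, `(∂_j S)(φ) = -S(∂_j φ)`. -/
def partialDeriv (j : Fin d) : 𝓓'(Ω, 𝕜) →L[𝕜] 𝓓'(Ω, 𝕜) where
  toFun S := ∂_{(Pi.single j 1 : Fin d → ℝ)} S
  map_add' S T := map_add (Distribution.lineDerivCLM (Pi.single j 1 : Fin d → ℝ)) S T
  map_smul' c S := by
    ext φ
    simp
  cont := (Distribution.lineDerivCLM (Pi.single j 1 : Fin d → ℝ)).continuous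

/-- The multiplication of distributions by the `j`-th coordinate, `(x_j S)(φ) = S(x_j φ)`. -/
def coordMul (j : Fin d) : 𝓓'(Ω, 𝕜) →L[𝕜] 𝓓'(Ω, 𝕜) where
  toFun S := (coordMulTest Ω j).precompCompactConvergenceCLM 𝕜 S
  map_add' S T := map_add ((coordMulTest Ω j).precompCompactConvergenceCLM 𝕜) S T
  map_smul' _ _ := rfl
  cont := ((coordMulTest Ω j).precompCompactConvergenceCLM 𝕜).continuous

/-- The operator `θ_j = x_j ∂/∂x_j` on `𝓓'(Ω)`. -/
def theta (j : Fin d) : 𝓓'(Ω, 𝕜) →L[𝕜] 𝓓'(Ω, 𝕜) :=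
  coordMul 𝕜 Ω j ∘L partialDeriv 𝕜 Ω j

theorem theta_apply (j : Fin d) (S : 𝓓'(Ω, 𝕜)) (φ : 𝓓(Ω, ℝ)) :
    theta 𝕜 Ω j S φ = -S (∂_{(Pi.single j 1 : Fin d → ℝ)} (coordMulTest Ω j φ)) := rfl

/-- The composition `θ^α = θ_1^{α_1} ∘ ⋯ ∘ θ_d^{α_d}`; product and powers are those of the ring
of continuous linear operators. -/
def thetaPow (α : Fin d →₀ ℕ) : 𝓓'(Ω, 𝕜) →L[𝕜] 𝓓'(Ω, 𝕜) :=
  (List.ofFn fun j => theta 𝕜 Ω j ^ α j).prod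

variable {𝕜} in
/-- The operator `P(θ) = ∑_α c_α θ^α` for the polynomial `P = ∑_α c_α X^α`. -/
def polyTheta (P : MvPolynomial (Fin d) 𝕜) : 𝓓'(Ω, 𝕜) →L[𝕜] 𝓓'(Ω, 𝕜) :=
  ∑ α ∈ P.support, P.coeff α • thetaPow 𝕜 Ω α

/-- The monomial `x ↦ x^α` as a distribution on `Ω`, namely `φ ↦ ∫ φ(x) x^α dx`. -/
def monomialDist (α : Fin d →₀ ℕ) : 𝓓'(Ω, 𝕜) :=
  TestFunction.integralAgainstBilinCLM (ContinuousLinearMap.lsmul ℝ ℝ : ℝ →L[ℝ] 𝕜 →L[ℝ] 𝕜)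
    volume (fun x : Fin d → ℝ => ∏ j, (x j : 𝕜) ^ α j)

theorem monomialDist_apply (α : Fin d →₀ ℕ) (φ : 𝓓(Ω, ℝ)) :
    monomialDist 𝕜 Ω α φ = ∫ x, φ x • ∏ j, (x j : 𝕜) ^ α j := by
  have h : Continuous fun x : Fin d → ℝ => ∏ j, (x j : 𝕜) ^ α j := by fun_prop
  exact TestFunction.integralAgainstBilinCLM_eq_integral
    (h.locallyIntegrable.locallyIntegrableOn _)

variable {𝕜 Ω}

/-- A Hadamard operator: a continuous linear operator on `𝓓'(Ω)` that admits every monomial as an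
eigenvector. -/
def IsHadamardOperator (L : 𝓓'(Ω, 𝕜) →L[𝕜] 𝓓'(Ω, 𝕜)) : Prop :=
  ∀ α : Fin d →₀ ℕ, ∃ m : 𝕜, Module.End.HasEigenvector
    (L : 𝓓'(Ω, 𝕜) →ₗ[𝕜] 𝓓'(Ω, 𝕜)) m (monomialDist 𝕜 Ω α)

/-- An Euler operator: an operator of the form `P(θ)` with a polynomial `P`. -/
def IsEulerOperator (L : 𝓓'(Ω, 𝕜) →L[𝕜] 𝓓'(Ω, 𝕜)) : Prop :=
  ∃ P : MvPolynomial (Fin d) 𝕜, L = polyTheta Ω P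

end Hadamard

end

/-!
The dual of `𝓓'(Ω)` is `𝓓(Ω)`, so that `x ↦ (L δ_x) φ` is a test function for every test function
`φ`, and test functions are determined by their moments. Comparing moments, an operator `L` that
maps monomials to multiples of themselves is therefore covariant under the dilations
`x ↦ (η_j x_j)_j`, and it is determined by its values on monomials.

By covariance a point `y ≠ x` of the support of `L δ_x`, where `y = η x`, would force `η` to map `Ω`
into itself; no dilation `η ≠ 1` does this when `Ω` is relatively compact in the orthant. So `L δ_x`
is supported at `x`. For one point `a ∈ Ω` the distribution `L δ_a` is then a linear combination of
derivatives of `δ_a`, equivalently of the distributions `θ^α δ_a`, that is, `L δ_a = P(θ) δ_a`. As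
`P(θ)` maps monomials to multiples of themselves, too, covariance yields `L δ_x = P(θ) δ_x` for all
`x`, hence `L = P(θ)`.
-/

noncomputable section

open Set Filter Topology
open scoped BoundedContinuousFunction ContDiff Pointwise

namespace Hadamard

theorem exists_compacts_exhaustion {X : Type*} [TopologicalSpace X] [LocallyCompactSpace X]
    [SecondCountableTopology X] (U : Opens X) : ∃ C : ℕ → Compacts X, Monotone C ∧
      (∀ n, (C n : Set X) ⊆ U) ∧ ∀ K : Compacts X, (K : Set X) ⊆ U → ∃ n, K ≤ C n := by
  have : LocallyCompactSpace U := U.isOpen.locallyCompactSpace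
  let C : CompactExhaustion U := default
  refine ⟨fun n => ⟨(↑) '' C n, (C.isCompact n).image continuous_subtype_val⟩,
    fun m n hmn => SetLike.coe_subset_coe.1 (image_mono (C.subset hmn)), fun n => ?_,
    fun K hK => ?_⟩
  · rintro _ ⟨x, -, rfl⟩
    exact x.2
  · have hc : IsCompact ((↑) ⁻¹' (K : Set X) : Set U) :=
      (IsInducing.subtypeVal.isCompact_preimage_iff (by simpa using hK)).2 K.isCompact
    obtain ⟨n, hn⟩ := C.exists_superset_of_isCompact hc
    exact ⟨n, fun x hx => ⟨⟨x, hK hx⟩, hn hx, rfl⟩⟩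

section TestFunctions

variable {E F : Type*} [NormedAddCommGroup E] [NormedSpace ℝ E]
  [NormedAddCommGroup F] [NormedSpace ℝ F] {K : Compacts E} {Ω : Opens E}

theorem hasFTaylorSeriesUpTo_of_tendstoUniformly {f : ℕ → E → F} (hf : ∀ n, ContDiff ℝ ∞ (f n))
    {p : E → FormalMultilinearSeries ℝ E F}
    (hp : ∀ i, TendstoUniformly (fun n x => iteratedFDeriv ℝ i (f n) x) (fun x => p x i) atTop) :
    HasFTaylorSeriesUpTo ∞ (fun x => (p x 0).curry0) p := by
  refine ⟨fun _ => rfl, fun i _ x => ?_, fun i _ => (hp i).continuous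
    (Frequently.of_forall fun n => (hf n).continuous_iteratedFDeriv (by exact_mod_cast le_top))⟩
  have hcurry : TendstoUniformly (fun n x => (iteratedFDeriv ℝ (i + 1) (f n) x).curryLeft)
      (fun x => (p x (i + 1)).curryLeft) atTop :=
    (continuousMultilinearCurryLeftEquiv ℝ (fun _ : Fin (i + 1) => E) F).isometry.uniformContinuous
      |>.comp_tendstoUniformly (hp (i + 1))
  exact hasFDerivAt_of_tendstoUniformly hcurry
    (fun n x => (hf n).ftaylorSeries.fderiv i (by exact_mod_cast WithTop.coe_lt_top _) x)
    (fun x => (hp i).tendsto_at x) x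

theorem isClosed_range_pi_structureMapCLM :
    IsClosed (range (ContinuousLinearMap.pi (ContDiffMapSupportedIn.structureMapCLM ℝ ⊤) :
      𝓓_{K}(E, F) →L[ℝ] Π i, E →ᵇ (E [×i]→L[ℝ] F))) := by
  refine IsSeqClosed.isClosed fun u g hu hg => ?_
  choose f hf using hu
  have hunif : ∀ i, TendstoUniformly (fun n x => iteratedFDeriv ℝ i (f n) x) (g i) atTop := by
    intro i
    have h := BoundedContinuousFunction.tendsto_iff_tendstoUniformly.1 (tendsto_pi_nhds.1 hg i)
    simpa only [← hf, ContinuousLinearMap.coe_pi',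
      ContDiffMapSupportedIn.structureMapCLM_top_apply] using h
  have hT := hasFTaylorSeriesUpTo_of_tendstoUniformly (p := fun x i => g i x)
    (fun n => (f n).contDiff) hunif
  have hzero : EqOn (fun x => (g 0 x).curry0) 0 (K : Set E)ᶜ := by
    intro x hx
    have h : g 0 x = 0 := tendsto_nhds_unique ((hunif 0).tendsto_at x)
      (tendsto_const_nhds.congr fun n => ((f n).iteratedFDeriv_zero_on_compl hx).symm)
    simp [h]
  refine ⟨⟨fun x => (g 0 x).curry0, hT.contDiff, hzero⟩, ?_⟩
  ext i x : 2
  rw [ContinuousLinearMap.coe_pi', ContDiffMapSupportedIn.structureMapCLM_top_apply]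
  exact (hT.eq_iteratedFDeriv (m := i) (by exact_mod_cast le_top) x).symm

instance [CompleteSpace F] : CompleteSpace 𝓓_{K}(E, F) :=
  (ContDiffMapSupportedIn.isUniformEmbedding_pi_structureMapCLM
    (n := ⊤) ℝ).isUniformInducing.completeSpace isClosed_range_pi_structureMapCLM.isComplete

/-- A test function as an element of `𝓓_K`, where `K` is its topological support. -/
def toSupportedIn (f : 𝓓(Ω, F)) : 𝓓_{⟨tsupport f, f.hasCompactSupport⟩}(E, F) :=
  .of_support_subset f.contDiff subset_closure

/- Instance search does not find these two when `G` is a space of continuous multilinear maps. -/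
instance boundedContinuousFunction_isTopologicalAddGroup (X G : Type*) [TopologicalSpace X]
    [SeminormedAddCommGroup G] : IsTopologicalAddGroup (X →ᵇ G) :=
  inferInstance

instance boundedContinuousFunction_locallyConvexSpace (X G : Type*) [TopologicalSpace X]
    [SeminormedAddCommGroup G] [NormedSpace ℝ G] : LocallyConvexSpace ℝ (X →ᵇ G) :=
  inferInstance

/-- The `i`-th derivative as a continuous linear map from test functions to bounded continuous
functions. -/
def iteratedFDerivCLM (i : ℕ) : 𝓓(Ω, F) →L[ℝ] E →ᵇ (E [×i]→L[ℝ] F) :=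
  TestFunction.limitCLM (V := E →ᵇ (E [×i]→L[ℝ] F)) ℝ
    (fun f : 𝓓(Ω, F) => ContDiffMapSupportedIn.structureMapCLM ℝ ⊤ i (toSupportedIn f))
    (fun _ _ => ContDiffMapSupportedIn.structureMapCLM ℝ ⊤ i)
    (fun K hK f => by
      ext x : 1
      simp only [ContDiffMapSupportedIn.structureMapCLM_top_apply]
      rfl)

theorem iteratedFDerivCLM_ofSupportedIn (i : ℕ) (hK : (K : Set E) ⊆ Ω) (f : 𝓓_{K}(E, F)) :
    iteratedFDerivCLM i (TestFunction.ofSupportedIn hK f) =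
      ContDiffMapSupportedIn.structureMapCLM ℝ ⊤ i f := by
  ext x : 1
  simp only [iteratedFDerivCLM, TestFunction.limitCLM_apply,
    ContDiffMapSupportedIn.structureMapCLM_top_apply]
  rfl

theorem isInducing_ofSupportedIn (hK : (K : Set E) ⊆ Ω) :
    IsInducing (TestFunction.ofSupportedIn hK : 𝓓_{K}(E, F) → 𝓓(Ω, F)) := by
  refine ⟨le_antisymm (TestFunction.continuous_ofSupportedIn hK).le_induced (le_iInf fun i => ?_)⟩
  have h : (ContDiffMapSupportedIn.structureMapLM ℝ ⊤ i : 𝓓_{K}(E, F) → _) =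
      iteratedFDerivCLM i ∘ (TestFunction.ofSupportedIn hK : 𝓓_{K}(E, F) → 𝓓(Ω, F)) :=
    funext fun f => (iteratedFDerivCLM_ofSupportedIn i hK f).symm
  rw [h, ← induced_compose]
  exact induced_mono (iteratedFDerivCLM i).continuous.le_induced

theorem mem_range_ofSupportedInCLM (hK : (K : Set E) ⊆ Ω) {f : 𝓓(Ω, F)} :
    f ∈ range (TestFunction.ofSupportedInCLM ℝ hK : 𝓓_{K}(E, F) →L[ℝ] 𝓓(Ω, F)) ↔
      ∀ x ∉ K, f x = 0 := by
  refine ⟨?_, fun h => ⟨⟨f, f.contDiff, fun x hx => h x hx⟩, rfl⟩⟩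
  rintro ⟨g, rfl⟩ x hx
  exact g.zero_on_compl hx

theorem isComplete_range_ofSupportedInCLM [CompleteSpace F] (hK : (K : Set E) ⊆ Ω) :
    IsComplete (range (TestFunction.ofSupportedInCLM ℝ hK : 𝓓_{K}(E, F) →L[ℝ] 𝓓(Ω, F))) :=
  (AddMonoidHom.isUniformInducing_of_isInducing
    (f := (TestFunction.ofSupportedInCLM ℝ hK : 𝓓_{K}(E, F) →L[ℝ] 𝓓(Ω, F)))
    (isInducing_ofSupportedIn hK)).isComplete_range

theorem exists_clm_forall_eq_smul_apply {x : ℕ → E}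
    (hx : ∀ K : Compacts E, (K : Set E) ⊆ Ω → {n | x n ∈ K}.Finite) (w : ℕ → ℝ) :
    ∃ Φ : 𝓓(Ω, F) →L[ℝ] ℕ →ᵇ F, ∀ f n, Φ f n = w n • f (x n) := by
  have hbdd : ∀ K : Compacts E, (K : Set E) ⊆ Ω →
      ∃ v : ℕ →ᵇ ℝ, ∀ n, v n = indicator {n | x n ∈ K} w n := by
    intro K hK
    obtain ⟨C, hC⟩ := (((hx K hK).image w).insert 0).isBounded.exists_norm_le
    refine ⟨.ofNormedAddCommGroupDiscrete (indicator {n | x n ∈ K} w) C fun n => ?_, fun _ => rfl⟩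
    by_cases hn : x n ∈ K
    · simpa [hn] using hC _ (mem_insert_of_mem _ (mem_image_of_mem w hn))
    · simpa [hn] using hC 0 (mem_insert _ _)
  choose v hv using hbdd
  let Φ (K : Compacts E) (hK : (K : Set E) ⊆ Ω) : 𝓓_{K}(E, F) →L[ℝ] ℕ →ᵇ F :=
    { toFun := fun f => v K hK •
        (ContDiffMapSupportedIn.toBoundedContinuousFunctionCLM ℝ f).compContinuous
          ⟨x, continuous_of_discreteTopology⟩
      map_add' := fun f g => by ext n; exact smul_add (v K hK n) (f (x n)) (g (x n))
      map_smul' := fun c f => by ext n; exact smul_comm (v K hK n) c (f (x n))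
      cont := ((BoundedContinuousFunction.continuous_compContinuous _).comp
        (ContDiffMapSupportedIn.toBoundedContinuousFunctionCLM ℝ).continuous).const_smul (v K hK) }
  have hΦ : ∀ K hK f n, Φ K hK f n = w n • f (x n) := by
    intro K hK f n
    change v K hK n • f (x n) = _
    by_cases hn : x n ∈ K
    · simp [hv, hn]
    · simp [f.zero_on_compl hn]
  refine ⟨TestFunction.limitCLM ℝ (fun f => Φ _ f.tsupport_subset (toSupportedIn f)) Φ
    fun K hK f => ?_, fun f n => hΦ _ _ _ n⟩
  ext n
  simp only [hΦ]
  rfl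

theorem exists_compacts_forall_eq_zero [FiniteDimensional ℝ E] {S : Set 𝓓(Ω, F)}
    (hS : IsCompact S) : ∃ K : Compacts E, (K : Set E) ⊆ Ω ∧ ∀ f ∈ S, ∀ x ∉ K, f x = 0 := by
  have : ProperSpace E := FiniteDimensional.proper ℝ E
  obtain ⟨C, hmono, hCΩ, hC⟩ := exists_compacts_exhaustion Ω
  by_contra! hcon
  choose f hfS x hxC hfx using fun n => hcon (C n) (hCΩ n)
  have hleave : ∀ K : Compacts E, (K : Set E) ⊆ Ω → {n | x n ∈ K}.Finite := by
    intro K hK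
    obtain ⟨N, hN⟩ := hC K hK
    exact (finite_lt_nat N).subset fun n hn =>
      not_le.1 fun hNn => hxC n (hmono hNn (hN hn))
  obtain ⟨Φ, hΦ⟩ := exists_clm_forall_eq_smul_apply (F := F) hleave fun n => n / ‖f n (x n)‖
  obtain ⟨B, hB⟩ := (hS.image Φ.continuous).isBounded.exists_norm_le
  obtain ⟨n, hn⟩ := exists_nat_gt B
  have hnorm : ‖Φ (f n) n‖ = n := by
    rw [hΦ, norm_smul, Real.norm_of_nonneg (by positivity),
      div_mul_cancel₀ _ (norm_ne_zero_iff.2 (hfx n))]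
  have hle : ‖Φ (f n) n‖ ≤ B :=
    ((Φ (f n)).norm_coe_le_norm n).trans (hB _ (mem_image_of_mem Φ (hfS n)))
  exact hn.not_ge (hnorm ▸ hle)

theorem isCompact_closure_convexHull [FiniteDimensional ℝ E] [CompleteSpace F] {S : Set 𝓓(Ω, F)}
    (hS : IsCompact S) : IsCompact (closure (convexHull ℝ S)) := by
  obtain ⟨K, hK, hSK⟩ := exists_compacts_forall_eq_zero hS
  have hcomplete := isComplete_range_ofSupportedInCLM (F := F) hK
  have hsub : closure (convexHull ℝ S) ⊆
      range (TestFunction.ofSupportedInCLM ℝ hK : 𝓓_{K}(E, F) →L[ℝ] 𝓓(Ω, F)) :=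
    closure_minimal (convexHull_min (fun f hf => (mem_range_ofSupportedInCLM hK).2 (hSK f hf))
      (LinearMap.range (TestFunction.ofSupportedInCLM ℝ hK :
        𝓓_{K}(E, F) →L[ℝ] 𝓓(Ω, F)).toLinearMap).convex) hcomplete.isClosed
  refine TotallyBounded.isCompact_of_isComplete
    (totallyBounded_convexHull.2 hS.totallyBounded).closure fun G hG hGS => ?_
  obtain ⟨f, -, hf⟩ := hcomplete G hG (hGS.trans (principal_mono.2 hsub))
  have := hG.1
  exact ⟨f, isClosed_closure.mem_of_tendsto (f := id) hf (le_principal_iff.1 hGS), hf⟩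

end TestFunctions

section Duality

open scoped CompactConvergenceCLM

variable {V : Type*} [AddCommGroup V] [Module ℝ V] [TopologicalSpace V]

theorem exists_mem_forall_apply_eq {C : Set V} (hC : IsCompact C) (hconv : Convex ℝ C)
    (ℓ : Module.Dual ℝ (V →L_c[ℝ] ℝ))
    (hℓ : ∀ (T : V →L_c[ℝ] ℝ) (u : ℝ), (∀ v ∈ C, T v < u) → ℓ T ≤ u) :
    ∃ v ∈ C, ∀ T, ℓ T = T v := by
  let B : Module.Dual ℝ (V →L_c[ℝ] ℝ) →ₗ[ℝ] (V →L_c[ℝ] ℝ) →ₗ[ℝ] ℝ := LinearMap.id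
  let ev : V →ₗ[ℝ] WeakBilin B :=
    { toFun := fun v =>
        { toFun := fun T => T v
          map_add' := fun _ _ => rfl
          map_smul' := fun _ _ => rfl }
      map_add' := fun v w => LinearMap.ext fun T => map_add T v w
      map_smul' := fun c v => LinearMap.ext fun T => map_smul T c v }
  have hev : Continuous ev := WeakBilin.continuous_of_continuous_eval B fun T =>
    ContinuousLinearMap.continuous T
  have : T2Space (WeakBilin B) := (WeakBilin.isEmbedding (B := B) Function.injective_id).t2Space
  by_contra! hne
  -- The continuous functionals on the weak algebraic dual of `V'` are the evaluations on `V'`.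
  obtain ⟨f, u, hfC, hfℓ⟩ := geometric_hahn_banach_closed_point (E := WeakBilin B) (x := ℓ)
    (hconv.linear_image ev) (hC.image hev).isClosed
    (by
      rintro ⟨v, hv, h⟩
      obtain ⟨T, hT⟩ := hne v hv
      exact hT (LinearMap.congr_fun h T).symm)
  obtain ⟨T, rfl⟩ := LinearMap.dualEmbedding_surjective B f
  exact (hℓ T u fun v hv => hfC _ (mem_image_of_mem ev hv)).not_gt hfℓ

variable [IsTopologicalAddGroup V] [ContinuousSMul ℝ V]

theorem exists_forall_apply_eq
    (hV : ∀ S : Set V, IsCompact S → IsCompact (closure (convexHull ℝ S)))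
    (ℓ : (V →L_c[ℝ] ℝ) →L[ℝ] ℝ) : ∃ v, ∀ T, ℓ T = T v := by
  have hnhds : ∀ᶠ T in 𝓝 (0 : V →L_c[ℝ] ℝ), ℓ T ≤ 1 :=
    (ℓ.continuous.tendsto' 0 0 (map_zero ℓ)).eventually_le_const one_pos
  obtain ⟨⟨S, ε⟩, ⟨hS, hε⟩, hSε⟩ := ((CompactConvergenceCLM.hasBasis_nhds_zero_of_basis
    (E := V) (σ := RingHom.id ℝ) Metric.nhds_basis_ball).eventually_iff).1 hnhds
  let S' : Set V := insert 0 (S ∪ -S)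
  have hS' : S' ⊆ closure (convexHull ℝ S') := (subset_convexHull ℝ S').trans subset_closure
  obtain ⟨v, -, hv⟩ := exists_mem_forall_apply_eq (hV S' ((hS.union hS.neg).insert 0))
    (convex_convexHull ℝ S').closure (ε • (ℓ : (V →L_c[ℝ] ℝ) →ₗ[ℝ] ℝ)) fun T u hT => by
      have hu : 0 < u := by simpa using hT 0 (hS' (mem_insert _ _))
      have hℓ : ℓ ((ε / u) • T) ≤ 1 := hSε fun w hw => by
        have h₁ := hT w (hS' (by simp [S', hw]))
        have h₂ := hT (-w) (hS' (by simp [S', hw]))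
        rw [map_neg] at h₂
        have hTw : |T w| < u := abs_lt.2 ⟨by linarith, h₁⟩
        simpa [abs_mul, abs_div, abs_of_pos hε, abs_of_pos hu, div_mul_eq_mul_div,
          div_lt_iff₀ hu] using mul_lt_mul_of_pos_left hTw hε
      rw [map_smul, smul_eq_mul, div_mul_eq_mul_div, div_le_one hu] at hℓ
      exact hℓ
  refine ⟨ε⁻¹ • v, fun T => ?_⟩
  rw [map_smul, ← hv T]
  simp [hε.ne']

end Duality

section DualOfDistributions

variable {E : Type*} [NormedAddCommGroup E] [NormedSpace ℝ E]
  {𝕜 : Type*} [RCLike 𝕜] {Ω : Opens E}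

variable (𝕜 Ω) in
/-- The Dirac distribution `δ_x` with values in `𝕜`; it vanishes for `x ∉ Ω`. -/
def dirac (x : E) : 𝓓'(Ω, 𝕜) :=
  Distribution.mapCLM RCLike.ofRealCLM (Distribution.delta x)

theorem dirac_apply (x : E) (φ : 𝓓(Ω, ℝ)) : dirac 𝕜 Ω x φ = φ x := rfl

theorem dirac_eq_zero_of_notMem {x : E} (hx : x ∉ Ω) : dirac 𝕜 Ω x = 0 := by
  rw [dirac, Distribution.delta_eq_zero_of_notMem x hx, map_zero]

/-- The evaluation of distributions at a test function. -/
def evalCLM (φ : 𝓓(Ω, ℝ)) : 𝓓'(Ω, 𝕜) →L[𝕜] 𝕜 where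
  toFun S := S φ
  map_add' _ _ := rfl
  map_smul' _ _ := rfl
  cont := continuous_eval_const φ

theorem evalCLM_apply (φ : 𝓓(Ω, ℝ)) (S : 𝓓'(Ω, 𝕜)) : evalCLM φ S = S φ := rfl

theorem eq_mapCLM_ofReal_re_add_I_smul_im (S : 𝓓'(Ω, 𝕜)) :
    S = Distribution.mapCLM RCLike.ofRealCLM (Distribution.mapCLM RCLike.reCLM S) +
      (RCLike.I : 𝕜) •
        Distribution.mapCLM RCLike.ofRealCLM (Distribution.mapCLM RCLike.imCLM S) := by
  ext φ
  change S φ = (RCLike.re (S φ) : 𝕜) + RCLike.I * (RCLike.im (S φ) : 𝕜)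
  rw [mul_comm, RCLike.re_add_im]

variable [FiniteDimensional ℝ E]

theorem exists_testFunction_pair_forall_eq (ℓ : 𝓓'(Ω, 𝕜) →L[𝕜] 𝕜) :
    ∃ ψ₁ ψ₂ : 𝓓(Ω, ℝ), ∀ S, ℓ S = S ψ₁ + RCLike.I * S ψ₂ := by
  let ℓ₀ : 𝓓'(Ω, ℝ) →L[ℝ] 𝕜 :=
    ℓ.restrictScalars ℝ ∘L Distribution.mapCLM RCLike.ofRealCLM
  obtain ⟨ψ₁, h₁⟩ := exists_forall_apply_eq (V := 𝓓(Ω, ℝ))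
    (fun _ => isCompact_closure_convexHull) (RCLike.reCLM ∘L ℓ₀)
  obtain ⟨ψ₂, h₂⟩ := exists_forall_apply_eq (V := 𝓓(Ω, ℝ))
    (fun _ => isCompact_closure_convexHull) (RCLike.imCLM ∘L ℓ₀)
  have h : ∀ T : 𝓓'(Ω, ℝ), ℓ (Distribution.mapCLM RCLike.ofRealCLM T) =
      (T ψ₁ : 𝕜) + RCLike.I * (T ψ₂ : 𝕜) := by
    intro T
    rw [← h₁ T, ← h₂ T, mul_comm]
    exact (RCLike.re_add_im _).symm
  refine ⟨ψ₁, ψ₂, fun S => ?_⟩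
  rw [eq_mapCLM_ofReal_re_add_I_smul_im S, map_add, map_smul, h, h]
  simp only [add_apply, smul_apply, smul_eq_mul, Distribution.mapCLM_apply, RCLike.ofRealCLM_apply]
  ring

theorem continuous_apply_dirac (ℓ : 𝓓'(Ω, 𝕜) →L[𝕜] 𝕜) : Continuous fun x => ℓ (dirac 𝕜 Ω x) := by
  obtain ⟨ψ₁, ψ₂, h⟩ := exists_testFunction_pair_forall_eq ℓ
  simp only [h, dirac_apply]
  fun_prop

theorem hasCompactSupport_apply_dirac (ℓ : 𝓓'(Ω, 𝕜) →L[𝕜] 𝕜) :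
    HasCompactSupport fun x => ℓ (dirac 𝕜 Ω x) := by
  obtain ⟨ψ₁, ψ₂, h⟩ := exists_testFunction_pair_forall_eq ℓ
  simp only [h, dirac_apply]
  have hψ : ∀ ψ : 𝓓(Ω, ℝ), HasCompactSupport fun x => (ψ x : 𝕜) := fun ψ =>
    ψ.hasCompactSupport.comp_left (g := fun t : ℝ => (t : 𝕜)) RCLike.ofReal_zero
  exact (hψ ψ₁).add (hψ ψ₂).mul_left

theorem eq_zero_of_forall_apply_dirac_eq_zero {ℓ : 𝓓'(Ω, 𝕜) →L[𝕜] 𝕜}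
    (h : ∀ x ∈ Ω, ℓ (dirac 𝕜 Ω x) = 0) : ℓ = 0 := by
  obtain ⟨ψ₁, ψ₂, hℓ⟩ := exists_testFunction_pair_forall_eq ℓ
  have hψ : ∀ x, (ψ₁ x : 𝕜) + RCLike.I * ψ₂ x = 0 := by
    intro x
    rw [← dirac_apply, ← dirac_apply, ← hℓ]
    by_cases hx : x ∈ Ω
    · exact h x hx
    · rw [dirac_eq_zero_of_notMem hx, map_zero]
  have h₁ : ψ₁ = 0 := by
    ext x
    simpa using congrArg RCLike.re (hψ x)
  have h₂ : (RCLike.I : 𝕜) = 0 ∨ ψ₂ = 0 := by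
    refine or_iff_not_imp_left.2 fun hI => ?_
    ext x
    simpa [h₁, hI] using hψ x
  ext S
  rw [hℓ, h₁]
  rcases h₂ with hI | rfl
  · simp [hI]
  · simp

theorem clm_eq_zero_of_forall_apply_dirac_eq_zero {M : 𝓓'(Ω, 𝕜) →L[𝕜] 𝓓'(Ω, 𝕜)}
    (h : ∀ x ∈ Ω, M (dirac 𝕜 Ω x) = 0) : M = 0 := by
  ext S φ
  have hφ : evalCLM φ ∘L M = 0 := eq_zero_of_forall_apply_dirac_eq_zero fun x hx => by
    simp [h x hx, evalCLM_apply]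
  exact congr($hφ S)

end DualOfDistributions

section Moments

theorem exists_mvPolynomial_near {ι : Type*} {g : (ι → ℝ) → ℝ} (hg : Continuous g) {K : Set (ι → ℝ)}
    (hK : IsCompact K) {ε : ℝ} (hε : 0 < ε) :
    ∃ p : MvPolynomial ι ℝ, ∀ x ∈ K, |p.eval x - g x| < ε := by
  let coord (i : ι) : C(ι → ℝ, ℝ) := ⟨fun x => x i, continuous_apply i⟩
  have hsep : (MvPolynomial.aeval (R := ℝ) coord).range.SeparatesPoints := by
    intro x y hxy
    obtain ⟨i, hi⟩ := Function.ne_iff.1 hxy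
    exact ⟨coord i, ⟨coord i, ⟨MvPolynomial.X i, by simp⟩, rfl⟩, hi⟩
  obtain ⟨_, ⟨p, rfl⟩, hp⟩ :=
    ContinuousMap.exists_mem_subalgebra_near_continuous_of_isCompact_of_separatesPoints hsep
      ⟨g, hg⟩ hK hε
  have heval : ∀ x, MvPolynomial.aeval coord p x = p.eval x := by
    intro x
    have h : (ContinuousMap.evalAlgHom ℝ ℝ x).comp (MvPolynomial.aeval coord) =
        MvPolynomial.aeval x := by
      ext i
      simp [coord]
    rw [← MvPolynomial.coe_aeval_eq_eval]
    exact congr($h p)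
  exact ⟨p, fun x hx => heval x ▸ hp x hx⟩

variable {ι F : Type*} [Fintype ι] [NormedAddCommGroup F] [NormedSpace ℝ F] {f : (ι → ℝ) → F}

theorem integral_eval_smul_eq_zero (hf : Continuous f) (hfc : HasCompactSupport f)
    (h : ∀ α : ι →₀ ℕ, ∫ x, (∏ i, x i ^ α i) • f x = 0) (p : MvPolynomial ι ℝ) :
    ∫ x, p.eval x • f x = 0 := by
  have hint : ∀ p : MvPolynomial ι ℝ, Integrable fun x => p.eval x • f x := fun p =>
    (p.continuous_eval.smul hf).integrable_of_hasCompactSupport hfc.smul_left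
  induction p using MvPolynomial.induction_on' with
  | monomial α a =>
    simp_rw [MvPolynomial.eval_monomial, Finsupp.prod_fintype _ _ (fun _ => pow_zero _), mul_smul]
    rw [integral_smul, h, smul_zero]
  | add p q hp hq =>
    simp_rw [map_add, add_smul]
    rw [integral_add (hint p) (hint q), hp, hq, add_zero]

theorem integral_smul_eq_zero_of_forall_moment_eq_zero (hf : Continuous f)
    (hfc : HasCompactSupport f) (h : ∀ α : ι →₀ ℕ, ∫ x, (∏ i, x i ^ α i) • f x = 0)
    {g : (ι → ℝ) → ℝ} (hg : Continuous g) : ∫ x, g x • f x = 0 := by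
  have hint : ∀ {g : (ι → ℝ) → ℝ}, Continuous g → Integrable fun x => g x • f x := fun hg =>
    (hg.smul hf).integrable_of_hasCompactSupport hfc.smul_left
  have hnorm : Integrable fun x => ‖f x‖ := (hf.integrable_of_hasCompactSupport hfc).norm
  have hbound : ∀ ε > 0, ‖∫ x, g x • f x‖ ≤ ε * ∫ x, ‖f x‖ := by
    intro ε hε
    obtain ⟨p, hp⟩ := exists_mvPolynomial_near hg hfc hε
    calc ‖∫ x, g x • f x‖ = ‖∫ x, (p.eval x - g x) • f x‖ := by
          simp_rw [sub_smul]
          rw [integral_sub (hint p.continuous_eval) (hint hg), integral_eval_smul_eq_zero hf hfc h,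
            zero_sub, norm_neg]
      _ ≤ ∫ x, ε * ‖f x‖ := by
          refine norm_integral_le_of_norm_le (hnorm.const_mul ε) (Eventually.of_forall fun x => ?_)
          by_cases hx : x ∈ tsupport f
          · rw [norm_smul]
            exact mul_le_mul_of_nonneg_right (hp x hx).le (norm_nonneg _)
          · simp [image_eq_zero_of_notMem_tsupport hx]
      _ = ε * ∫ x, ‖f x‖ := integral_const_mul _ _
  have hlim : Tendsto (fun ε => ε * ∫ x, ‖f x‖) (𝓝[>] 0) (𝓝 0) :=
    ((continuous_mul_const (∫ x, ‖f x‖)).tendsto' 0 0 (zero_mul _)).mono_left nhdsWithin_le_nhds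
  exact norm_le_zero_iff.1 (ge_of_tendsto hlim (eventually_mem_nhdsWithin.mono hbound))

theorem eq_zero_of_forall_moment_eq_zero [CompleteSpace F] (hf : Continuous f)
    (hfc : HasCompactSupport f) (h : ∀ α : ι →₀ ℕ, ∫ x, (∏ i, x i ^ α i) • f x = 0) : f = 0 :=
  (Continuous.ae_eq_iff_eq volume hf continuous_zero).1 <|
    ae_eq_zero_of_integral_contDiff_smul_eq_zero hf.locallyIntegrable fun _ hg _ =>
      integral_smul_eq_zero_of_forall_moment_eq_zero hf hfc h hg.continuous

end Moments

section MonomialDistributions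

variable {d : ℕ} {𝕜 : Type*} [RCLike 𝕜] {Ω : Opens (Fin d → ℝ)}

theorem monomialDist_apply_eq_integral_smul (α : Fin d →₀ ℕ) (φ : 𝓓(Ω, ℝ)) :
    monomialDist 𝕜 Ω α φ = ∫ x, (∏ j, x j ^ α j) • (φ x : 𝕜) := by
  rw [monomialDist_apply]
  congr! 2 with x
  simp only [RCLike.real_smul_eq_coe_mul, RCLike.ofReal_prod, RCLike.ofReal_pow]
  exact mul_comm _ _

theorem integrable_prod_pow_smul {F : Type*} [NormedAddCommGroup F] [NormedSpace ℝ F]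
    {f : (Fin d → ℝ) → F} (hf : Continuous f) (hfc : HasCompactSupport f) (α : Fin d →₀ ℕ) :
    Integrable fun x => (∏ j, x j ^ α j) • f x :=
  have hα : Continuous fun x : Fin d → ℝ => ∏ j, x j ^ α j := by fun_prop
  (hα.smul hf).integrable_of_hasCompactSupport hfc.smul_left

theorem integral_prod_pow_smul_apply_dirac (ℓ : 𝓓'(Ω, 𝕜) →L[𝕜] 𝕜) (α : Fin d →₀ ℕ) :
    ∫ x, (∏ j, x j ^ α j) • ℓ (dirac 𝕜 Ω x) = ℓ (monomialDist 𝕜 Ω α) := by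
  obtain ⟨ψ₁, ψ₂, h⟩ := exists_testFunction_pair_forall_eq ℓ
  have hint : ∀ ψ : 𝓓(Ω, ℝ), Integrable fun x => (∏ j, x j ^ α j) • (ψ x : 𝕜) := fun ψ =>
    integrable_prod_pow_smul (by fun_prop)
      (ψ.hasCompactSupport.comp_left (g := fun t : ℝ => (t : 𝕜)) RCLike.ofReal_zero) α
  rw [h, monomialDist_apply_eq_integral_smul, monomialDist_apply_eq_integral_smul,
    ← integral_const_mul, ← integral_add (hint _) ((hint _).const_mul _)]
  simp only [h, dirac_apply, smul_add, mul_smul_comm]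

theorem eq_zero_of_forall_apply_monomialDist_eq_zero {ℓ : 𝓓'(Ω, 𝕜) →L[𝕜] 𝕜}
    (h : ∀ α, ℓ (monomialDist 𝕜 Ω α) = 0) : ℓ = 0 := by
  have hzero : (fun x => ℓ (dirac 𝕜 Ω x)) = 0 :=
    eq_zero_of_forall_moment_eq_zero (continuous_apply_dirac ℓ) (hasCompactSupport_apply_dirac ℓ)
      fun α => by rw [integral_prod_pow_smul_apply_dirac, h]
  exact eq_zero_of_forall_apply_dirac_eq_zero fun x _ => congr_fun hzero x

theorem clm_ext_monomialDist {L M : 𝓓'(Ω, 𝕜) →L[𝕜] 𝓓'(Ω, 𝕜)}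
    (h : ∀ α, L (monomialDist 𝕜 Ω α) = M (monomialDist 𝕜 Ω α)) : L = M := by
  ext S φ
  have hφ : evalCLM φ ∘L (L - M) = 0 :=
    eq_zero_of_forall_apply_monomialDist_eq_zero fun α => by simp [h]
  exact sub_eq_zero.1 congr($hφ S)

end MonomialDistributions

theorem exists_integral_comp_continuousLinearEquiv {E F : Type*} [NormedAddCommGroup E]
    [NormedSpace ℝ E] [FiniteDimensional ℝ E] [MeasurableSpace E] [BorelSpace E]
    [NormedAddCommGroup F] [NormedSpace ℝ F] (μ : Measure E) [μ.IsAddHaarMeasure] (e : E ≃L[ℝ] E) :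
    ∃ c : ℝ, ∀ f : E → F, ∫ x, f (e x) ∂μ = c • ∫ x, f x ∂μ := by
  have : (μ.map e).IsAddHaarMeasure := e.isAddHaarMeasure_map μ
  refine ⟨(μ.map e).addHaarScalarFactor μ, fun f => ?_⟩
  calc ∫ x, f (e x) ∂μ = ∫ x, f x ∂μ.map e :=
        (e.toHomeomorph.measurableEmbedding.integral_map f).symm
    _ = ((μ.map e).addHaarScalarFactor μ : ℝ) • ∫ x, f x ∂μ := by
        conv_lhs => rw [Measure.isAddLeftInvariant_eq_smul (μ.map e) μ]
        rw [integral_smul_nnreal_measure]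
        rfl

section Dilations

variable {d : ℕ}

/-- The dilation `x ↦ (x_j η_j)_j` of `ℝ^d`; its factors may be negative. -/
def dilation (η : Fin d → ℝˣ) : (Fin d → ℝ) ≃L[ℝ] (Fin d → ℝ) :=
  ContinuousLinearEquiv.piCongrRight fun j => ContinuousLinearEquiv.unitsEquivAut ℝ (η j)

theorem dilation_apply (η : Fin d → ℝˣ) (x : Fin d → ℝ) (j : Fin d) :
    dilation η x j = x j * η j := rfl

theorem dilation_comm (η ρ : Fin d → ℝˣ) (x : Fin d → ℝ) :
    dilation η (dilation ρ x) = dilation ρ (dilation η x) := by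
  ext j
  simp only [dilation_apply, mul_right_comm]

theorem exists_dilation_eq {x y : Fin d → ℝ} (hx : ∀ j, x j ≠ 0) (hy : ∀ j, y j ≠ 0) :
    ∃ η : Fin d → ℝˣ, dilation η x = y := by
  refine ⟨fun j => Units.mk0 (y j / x j) (div_ne_zero (hy j) (hx j)), ?_⟩
  ext j
  exact mul_div_cancel₀ (y j) (hx j)

theorem exists_integral_prod_pow_smul_comp_dilation {F : Type*} [NormedAddCommGroup F]
    [NormedSpace ℝ F] (η : Fin d → ℝˣ) (α : Fin d →₀ ℕ) :
    ∃ c : ℝ, ∀ f : (Fin d → ℝ) → F, ∫ x, (∏ j, x j ^ α j) • f (dilation η x) =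
      c • ∫ x, (∏ j, x j ^ α j) • f x := by
  obtain ⟨c, hc⟩ := exists_integral_comp_continuousLinearEquiv (F := F) volume (dilation η)
  have hη : ∏ j, (η j : ℝ) ^ α j ≠ 0 :=
    Finset.prod_ne_zero_iff.2 fun j _ => pow_ne_zero _ (η j).ne_zero
  refine ⟨(∏ j, (η j : ℝ) ^ α j)⁻¹ * c, fun f => ?_⟩
  rw [mul_smul, ← hc fun x => (∏ j, x j ^ α j) • f x, ← integral_smul]
  congr! 2 with x
  simp only [dilation_apply, mul_pow, Finset.prod_mul_distrib]
  rw [smul_smul, mul_comm, mul_inv_cancel_right₀ hη]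

end Dilations

theorem exists_testFunction_comp {E F : Type*} [NormedAddCommGroup E] [NormedSpace ℝ E]
    [NormedAddCommGroup F] [NormedSpace ℝ F] {Ω : Opens E} (e : E ≃L[ℝ] E) (φ : 𝓓(Ω, F))
    (h : e ⁻¹' tsupport φ ⊆ Ω) : ∃ χ : 𝓓(Ω, F), ∀ x, χ x = φ (e x) := by
  refine ⟨⟨φ ∘ e, φ.contDiff.comp e.contDiff,
    φ.hasCompactSupport.comp_isClosedEmbedding e.toHomeomorph.isClosedEmbedding, ?_⟩, fun _ => rfl⟩
  exact (tsupport_comp_eq_preimage φ e.toHomeomorph).trans_subset h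

section DiagonalOperators

variable {d : ℕ} {𝕜 : Type*} [RCLike 𝕜] {Ω : Opens (Fin d → ℝ)}
  {L M : 𝓓'(Ω, 𝕜) →L[𝕜] 𝓓'(Ω, 𝕜)}

/-- An operator on `𝓓'(Ω)` that maps every monomial to a multiple of itself. Unlike an eigenvector,
the monomial may vanish, so that these operators form a vector space for every `Ω`. -/
def IsDiagonal (L : 𝓓'(Ω, 𝕜) →L[𝕜] 𝓓'(Ω, 𝕜)) : Prop :=
  ∀ α, ∃ m : 𝕜, L (monomialDist 𝕜 Ω α) = m • monomialDist 𝕜 Ω α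

theorem IsHadamardOperator.isDiagonal (hL : IsHadamardOperator L) : IsDiagonal L := fun α =>
  let ⟨m, hm⟩ := hL α
  ⟨m, hm.apply_eq_smul⟩

theorem IsDiagonal.sub (hL : IsDiagonal L) (hM : IsDiagonal M) : IsDiagonal (L - M) := by
  intro α
  obtain ⟨m, hm⟩ := hL α
  obtain ⟨n, hn⟩ := hM α
  exact ⟨m - n, (congrArg₂ (· - ·) hm hn).trans (sub_smul m n _).symm⟩

theorem IsDiagonal.apply_dirac_dilation (hL : IsDiagonal L) {φ χ : 𝓓(Ω, ℝ)} {η : Fin d → ℝˣ}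
    (h : ∀ x, χ x = φ (dilation η x)) (x : Fin d → ℝ) :
    L (dirac 𝕜 Ω (dilation η x)) φ = L (dirac 𝕜 Ω x) χ := by
  let u (ψ : 𝓓(Ω, ℝ)) (x : Fin d → ℝ) : 𝕜 := (evalCLM ψ ∘L L) (dirac 𝕜 Ω x)
  have hu (ψ) : Continuous (u ψ) := continuous_apply_dirac _
  have hu' (ψ) : HasCompactSupport (u ψ) := hasCompactSupport_apply_dirac _
  have hv : Continuous (u φ ∘ dilation η) := (hu φ).comp (dilation η).continuous
  have hv' : HasCompactSupport (u φ ∘ dilation η) :=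
    (hu' φ).comp_isClosedEmbedding (dilation η).toHomeomorph.isClosedEmbedding
  suffices u φ ∘ dilation η - u χ = 0 from sub_eq_zero.1 (congr_fun this x)
  refine eq_zero_of_forall_moment_eq_zero (hv.sub (hu χ)) (hv'.sub (hu' χ)) fun α => ?_
  obtain ⟨m, hm⟩ := hL α
  obtain ⟨c, hc⟩ := exists_integral_prod_pow_smul_comp_dilation (F := 𝕜) η α
  have hmoment (ψ) : ∫ x, (∏ j, x j ^ α j) • u ψ x = m * ∫ x, (∏ j, x j ^ α j) • (ψ x : 𝕜) := by
    rw [integral_prod_pow_smul_apply_dirac, ContinuousLinearMap.comp_apply, hm, map_smul,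
      evalCLM_apply, monomialDist_apply_eq_integral_smul, smul_eq_mul]
  simp only [Pi.sub_apply, smul_sub]
  rw [integral_sub (integrable_prod_pow_smul hv hv' α) (integrable_prod_pow_smul (hu χ) (hu' χ) α),
    sub_eq_zero]
  calc ∫ x, (∏ j, x j ^ α j) • u φ (dilation η x)
      = c • (m * ∫ x, (∏ j, x j ^ α j) • (φ x : 𝕜)) := by rw [hc, hmoment]
    _ = m * ∫ x, (∏ j, x j ^ α j) • (φ (dilation η x) : 𝕜) := by
        rw [hc fun x => (φ x : 𝕜), mul_smul_comm]
    _ = ∫ x, (∏ j, x j ^ α j) • u χ x := by simp only [hmoment, h]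

end DiagonalOperators

section Supports

variable {E F : Type*} [NormedAddCommGroup E] [NormedSpace ℝ E]
  [NormedAddCommGroup F] [NormedSpace ℝ F] {Ω : Opens E}

open Distribution

/-- The product of a test function with a smooth function on the whole space. -/
def smoothMul {g : E → ℝ} (hg : ContDiff ℝ ∞ g) (φ : 𝓓(Ω, ℝ)) : 𝓓(Ω, ℝ) :=
  ⟨fun x => g x * φ x, hg.mul φ.contDiff, φ.hasCompactSupport.mul_left,
    tsupport_mul_subset_right.trans φ.tsupport_subset⟩

theorem smoothMul_apply {g : E → ℝ} (hg : ContDiff ℝ ∞ g) (φ : 𝓓(Ω, ℝ)) (x : E) :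
    smoothMul hg φ x = g x * φ x := rfl

theorem tsupport_smoothMul_subset {g : E → ℝ} (hg : ContDiff ℝ ∞ g) (φ : 𝓓(Ω, ℝ)) :
    tsupport (smoothMul hg φ) ⊆ tsupport g :=
  tsupport_mul_subset_left

variable [FiniteDimensional ℝ E]

theorem exists_sum_eq_of_tsupport_subset_iUnion {ι : Type*} (φ : 𝓓(Ω, ℝ)) {U : ι → Set E}
    (hU : ∀ i, IsOpen (U i)) (hφ : tsupport φ ⊆ ⋃ i, U i) :
    ∃ (t : Finset ι) (ψ : t → 𝓓(Ω, ℝ)), φ = ∑ i, ψ i ∧ ∀ i, tsupport (ψ i) ⊆ U i := by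
  obtain ⟨t, ht⟩ := φ.hasCompactSupport.isCompact.elim_finite_subcover U hU hφ
  obtain ⟨f, hf⟩ := SmoothPartitionOfUnity.exists_isSubordinate (modelWithCornersSelf ℝ E)
    (isClosed_tsupport φ) (fun i : t => U i) (fun i => hU i)
    (fun x hx => by simpa only [mem_iUnion, Subtype.exists, exists_prop] using ht hx)
  have hf' (i) : ContDiff ℝ ∞ (f i) := (f i).contMDiff.contDiff
  refine ⟨t, fun i => smoothMul (hf' i) φ, ?_,
    fun i => (tsupport_smoothMul_subset _ _).trans (hf i)⟩
  ext x
  simp only [sum_apply, smoothMul_apply, ← Finset.sum_mul]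
  by_cases hx : x ∈ tsupport φ
  · rw [← finsum_eq_sum_of_fintype, f.sum_eq_one hx, one_mul]
  · rw [image_eq_zero_of_notMem_tsupport hx, mul_zero]

theorem apply_eq_zero_of_disjoint_dsupport {T : 𝓓'(Ω, F)} {φ : 𝓓(Ω, ℝ)}
    (h : Disjoint (tsupport φ) (dsupport T)) : T φ = 0 := by
  have hφ : tsupport φ ⊆ ⋃ s : {s : Set E // IsVanishingOn T s ∧ IsOpen s}, s := by
    intro x hx
    obtain ⟨s, hs, hso, hxs⟩ := (notMem_dsupport_iff x).1 (disjoint_left.1 h hx)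
    exact mem_iUnion.2 ⟨⟨s, hs, hso⟩, hxs⟩
  obtain ⟨t, ψ, rfl, hψ⟩ := exists_sum_eq_of_tsupport_subset_iUnion φ (fun s => s.2.2) hφ
  rw [map_sum]
  exact Finset.sum_eq_zero fun s _ => s.1.2.1 _ (hψ s)

end Supports

section Locality

variable {d : ℕ} {𝕜 : Type*} [RCLike 𝕜] {Ω : Opens (Fin d → ℝ)}
  {L M : 𝓓'(Ω, 𝕜) →L[𝕜] 𝓓'(Ω, 𝕜)}

open Distribution

theorem IsDiagonal.dilation_notMem_dsupport (hL : IsDiagonal L) (η : Fin d → ℝˣ)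
    {x z : Fin d → ℝ} (hx : L (dirac 𝕜 Ω x) = 0) (hz : z ∈ Ω) :
    dilation η z ∉ dsupport (L (dirac 𝕜 Ω (dilation η x))) := by
  refine (notMem_dsupport_iff _).2 ⟨dilation η '' Ω, fun φ hφ => ?_,
    (dilation η).toHomeomorph.isOpenMap _ Ω.isOpen, mem_image_of_mem _ hz⟩
  obtain ⟨χ, hχ⟩ := exists_testFunction_comp (dilation η) φ
    (((dilation η).injective.preimage_image (Ω : Set (Fin d → ℝ))).subst (preimage_mono hφ))
  rw [hL.apply_dirac_dilation hχ, hx, zero_apply]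

/-- The only dilation that maps `Ω` into itself is the identity. -/
def IsDilationRigid (Ω : Set (Fin d → ℝ)) : Prop :=
  ∀ η : Fin d → ℝˣ, MapsTo (dilation η) Ω Ω → η = 1

/- With `η y = x`, some `z ∈ Ω` has `η z ∉ Ω`, so `L δ_{η z} = 0`. The dilation that maps `z` to
`y` maps `η z` to `x`, and carries this over to the vanishing of `L δ_x` near `y`. -/
theorem IsDiagonal.notMem_dsupport_of_ne (hL : IsDiagonal L)
    (hΩ : IsDilationRigid (Ω : Set (Fin d → ℝ))) (hΩ₀ : ∀ x ∈ Ω, ∀ j, x j ≠ 0)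
    {x y : Fin d → ℝ} (hx : x ∈ Ω) (hy : y ∈ Ω) (hxy : x ≠ y) :
    y ∉ dsupport (L (dirac 𝕜 Ω x)) := by
  obtain ⟨η, rfl⟩ := exists_dilation_eq (hΩ₀ y hy) (hΩ₀ x hx)
  have hη : ¬MapsTo (dilation η) Ω Ω := by
    intro h
    refine hxy (funext fun j => ?_)
    rw [hΩ η h, dilation_apply, Pi.one_apply, Units.val_one, mul_one]
  obtain ⟨z, hz, hηz⟩ : ∃ z ∈ Ω, dilation η z ∉ Ω := by simpa [MapsTo] using hη
  obtain ⟨ρ, rfl⟩ := exists_dilation_eq (hΩ₀ z hz) (hΩ₀ y hy)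
  rw [dilation_comm]
  exact hL.dilation_notMem_dsupport ρ (by rw [dirac_eq_zero_of_notMem hηz, map_zero]) hz

theorem IsDiagonal.apply_dirac_eq_zero_of_notMem_tsupport (hL : IsDiagonal L)
    (hΩ : IsDilationRigid (Ω : Set (Fin d → ℝ))) (hΩ₀ : ∀ x ∈ Ω, ∀ j, x j ≠ 0)
    {x : Fin d → ℝ} (hx : x ∈ Ω) {φ : 𝓓(Ω, ℝ)} (hφ : x ∉ tsupport φ) :
    L (dirac 𝕜 Ω x) φ = 0 :=
  apply_eq_zero_of_disjoint_dsupport <| disjoint_left.2 fun _ hy =>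
    hL.notMem_dsupport_of_ne hΩ hΩ₀ hx (φ.tsupport_subset hy) fun h => hφ (h ▸ hy)

theorem IsDiagonal.eq_zero_of_apply_dirac_eq_zero (hL : IsDiagonal L)
    (hΩ : IsDilationRigid (Ω : Set (Fin d → ℝ))) (hΩ₀ : ∀ x ∈ Ω, ∀ j, x j ≠ 0)
    {a : Fin d → ℝ} (ha : a ∈ Ω) (h : L (dirac 𝕜 Ω a) = 0) : L = 0 := by
  refine clm_eq_zero_of_forall_apply_dirac_eq_zero fun x hx => ?_
  ext φ
  refine apply_eq_zero_of_disjoint_dsupport (disjoint_left.2 fun y hy => ?_)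
  rcases eq_or_ne x y with rfl | hxy
  · obtain ⟨η, rfl⟩ := exists_dilation_eq (hΩ₀ a ha) (hΩ₀ x hx)
    exact hL.dilation_notMem_dsupport η h ha
  · exact hL.notMem_dsupport_of_ne hΩ hΩ₀ hx (φ.tsupport_subset hy) hxy

theorem IsDiagonal.eq_of_apply_dirac_eq (hL : IsDiagonal L) (hM : IsDiagonal M)
    (hΩ : IsDilationRigid (Ω : Set (Fin d → ℝ))) (hΩ₀ : ∀ x ∈ Ω, ∀ j, x j ≠ 0)
    {a : Fin d → ℝ} (ha : a ∈ Ω) (h : L (dirac 𝕜 Ω a) = M (dirac 𝕜 Ω a)) : L = M :=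
  sub_eq_zero.1 <| (hL.sub hM).eq_zero_of_apply_dirac_eq_zero hΩ hΩ₀ ha (sub_eq_zero.2 h)

end Locality

section Rigidity

variable {d : ℕ} {Ω : Set (Fin d → ℝ)}

theorem isDilationRigid_of_relativelyCompactIn_posOrthant (hne : Ω.Nonempty)
    (hΩ : RelativelyCompactIn Ω (posOrthant d)) : IsDilationRigid Ω := by
  intro η hη
  have hη' : MapsTo (dilation η) (closure Ω) (closure Ω) := hη.closure (dilation η).continuous
  ext j
  have hj : ContinuousOn (fun x : Fin d → ℝ => x j) (closure Ω) := (continuous_apply j).continuousOn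
  obtain ⟨x, hx, hmax⟩ := hΩ.1.exists_isMaxOn hne.closure hj
  obtain ⟨y, hy, hmin⟩ := hΩ.1.exists_isMinOn hne.closure hj
  have hle : x j * η j ≤ x j := hmax (hη' hx)
  have hge : y j ≤ y j * η j := hmin (hη' hy)
  exact le_antisymm ((mul_le_iff_le_one_right (hΩ.2 hx j)).1 hle)
    ((le_mul_iff_one_le_right (hΩ.2 hy j)).1 hge)

end Rigidity

section FiniteOrder

variable {E F : Type*} [NormedAddCommGroup E] [NormedSpace ℝ E] [NormedAddCommGroup F]
  [NormedSpace ℝ F]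

theorem exists_forall_norm_iteratedFDeriv_le {f : E → F} (hf : ContDiff ℝ ∞ f)
    (hfc : HasCompactSupport f) (k : ℕ) :
    ∃ C, ∀ j ≤ k, ∀ x, ‖iteratedFDeriv ℝ j f x‖ ≤ C := by
  have h (j : ℕ) : ∃ C, ∀ x, ‖iteratedFDeriv ℝ j f x‖ ≤ C :=
    (hf.continuous_iteratedFDeriv (by exact_mod_cast le_top)).bounded_above_of_compact_support
      (hfc.iteratedFDeriv j)
  choose C hC using h
  obtain ⟨B, hB⟩ := ((finite_Iic k).image C).bddAbove
  exact ⟨B, fun j hj x => (hC j x).trans (hB (mem_image_of_mem C hj))⟩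

theorem norm_iteratedFDeriv_le_mul_pow {f : E → F} (hf : ContDiff ℝ ∞ f) {a : E} {k : ℕ} {M : ℝ}
    (hM : ∀ x, ‖iteratedFDeriv ℝ (k + 1) f x‖ ≤ M) (ha : ∀ i ≤ k, iteratedFDeriv ℝ i f a = 0)
    {i n : ℕ} (hin : i + n = k + 1) (x : E) : ‖iteratedFDeriv ℝ i f x‖ ≤ M * ‖x - a‖ ^ n := by
  have hM₀ : 0 ≤ M := (norm_nonneg _).trans (hM a)
  induction n generalizing i x with
  | zero =>
    obtain rfl : i = k + 1 := hin
    simpa using hM x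
  | succ n ih =>
    have hd : Differentiable ℝ (iteratedFDeriv ℝ i f) :=
      hf.differentiable_iteratedFDeriv (by exact_mod_cast WithTop.coe_lt_top _)
    have hfderiv : ∀ y ∈ Metric.closedBall a ‖x - a‖,
        ‖fderiv ℝ (iteratedFDeriv ℝ i f) y‖ ≤ M * ‖x - a‖ ^ n := by
      intro y hy
      rw [norm_fderiv_iteratedFDeriv]
      refine (ih (by omega) y).trans ?_
      have : ‖y - a‖ ≤ ‖x - a‖ := mem_closedBall_iff_norm.1 hy
      gcongr
    have hmv := (convex_closedBall a ‖x - a‖).norm_image_sub_le_of_norm_fderiv_le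
      (fun y _ => hd y) hfderiv (Metric.mem_closedBall_self (norm_nonneg _))
      (mem_closedBall_iff_norm.2 le_rfl)
    rwa [ha i (by omega), sub_zero, mul_assoc, ← pow_succ] at hmv

theorem norm_iteratedFDeriv_comp_smul_sub {f : E → F} (hf : ContDiff ℝ ∞ f) {r : ℝ} (hr : 0 < r)
    (a x : E) (j : ℕ) : ‖iteratedFDeriv ℝ j (fun y => f (r • (y - a))) x‖ =
      r ^ j * ‖iteratedFDeriv ℝ j f (r • (x - a))‖ := by
  rw [iteratedFDeriv_comp_sub (f := fun y => f (r • y)),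
    iteratedFDeriv_comp_const_smul r (hf.of_le (by exact_mod_cast le_top)), norm_smul, norm_pow,
    Real.norm_of_nonneg hr.le]

theorem exists_forall_exists_cutoff [FiniteDimensional ℝ E] (a : E) (k : ℕ) :
    ∃ B : ℝ, ∀ ε > 0, ∃ χ : E → ℝ, ContDiff ℝ ∞ χ ∧ χ =ᶠ[𝓝 a] 1 ∧
      tsupport χ ⊆ Metric.closedBall a ε ∧
      ∀ j ≤ k, ∀ x, ‖iteratedFDeriv ℝ j χ x‖ ≤ ε⁻¹ ^ j * B := by
  let b : ContDiffBump (0 : E) := ⟨1 / 2, 1, by norm_num, by norm_num⟩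
  have hb : ContDiff ℝ ∞ b := b.contDiff
  obtain ⟨B, hB⟩ := exists_forall_norm_iteratedFDeriv_le hb b.hasCompactSupport k
  refine ⟨B, fun ε hε => ⟨fun y => b (ε⁻¹ • (y - a)), hb.comp (by fun_prop), ?_, ?_, ?_⟩⟩
  · have ha : Tendsto (fun y => ε⁻¹ • (y - a)) (𝓝 a) (𝓝 0) :=
      Continuous.tendsto' (by fun_prop) _ _ (by simp)
    exact ha.eventually b.eventuallyEq_one
  · refine closure_minimal (fun y hy => ?_) Metric.isClosed_closedBall
    have hy' : ε⁻¹ • (y - a) ∈ Metric.ball (0 : E) 1 := b.support_eq ▸ hy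
    rw [mem_ball_zero_iff, norm_smul, norm_inv, Real.norm_of_nonneg hε.le, inv_mul_lt_iff₀ hε,
      mul_one] at hy'
    exact mem_closedBall_iff_norm.2 hy'.le
  · intro j hj x
    rw [norm_iteratedFDeriv_comp_smul_sub hb (inv_pos.2 hε)]
    gcongr
    exact hB j hj _

theorem norm_iteratedFDeriv_mul_le_of_le {χ f : E → ℝ} (hχ : ContDiff ℝ ∞ χ) (hf : ContDiff ℝ ∞ f)
    {x : E} {k : ℕ} {B M ε : ℝ} (hε : 0 < ε) (hε₁ : ε ≤ 1)
    (hB : ∀ j ≤ k, ‖iteratedFDeriv ℝ j χ x‖ ≤ ε⁻¹ ^ j * B)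
    (hM : ∀ i n, i + n = k + 1 → ‖iteratedFDeriv ℝ i f x‖ ≤ M * ε ^ n) {i : ℕ} (hi : i ≤ k) :
    ‖iteratedFDeriv ℝ i (fun y => χ y * f y) x‖ ≤ 2 ^ k * (B * M * ε) := by
  have hB₀ : 0 ≤ B := by simpa using (norm_nonneg _).trans (hB 0 k.zero_le)
  have hM₀ : 0 ≤ M := by simpa using (norm_nonneg _).trans (hM (k + 1) 0 rfl)
  have hterm : ∀ j ∈ Finset.range (i + 1), (i.choose j : ℝ) * ‖iteratedFDeriv ℝ j χ x‖ *
      ‖iteratedFDeriv ℝ (i - j) f x‖ ≤ i.choose j * (B * M * ε) := by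
    intro j hj
    have hji : j ≤ i := Finset.mem_range_succ_iff.1 hj
    rw [mul_assoc]
    refine mul_le_mul_of_nonneg_left ?_ (Nat.cast_nonneg _)
    calc ‖iteratedFDeriv ℝ j χ x‖ * ‖iteratedFDeriv ℝ (i - j) f x‖
        ≤ ε⁻¹ ^ j * B * (M * ε ^ (j + (k + 1 - i))) := by
          gcongr
          · exact hB j (hji.trans hi)
          · exact hM _ _ (by omega)
      _ = B * M * ε ^ (k + 1 - i) := by
          rw [pow_add, inv_pow]
          field_simp
      _ ≤ B * M * ε := by
          gcongr
          exact pow_le_of_le_one hε.le hε₁ (by omega)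
  calc ‖iteratedFDeriv ℝ i (fun y => χ y * f y) x‖
      ≤ ∑ j ∈ Finset.range (i + 1), (i.choose j : ℝ) * ‖iteratedFDeriv ℝ j χ x‖ *
          ‖iteratedFDeriv ℝ (i - j) f x‖ :=
        norm_iteratedFDeriv_mul_le hχ hf x (by exact_mod_cast le_top)
    _ ≤ ∑ j ∈ Finset.range (i + 1), i.choose j * (B * M * ε) := Finset.sum_le_sum hterm
    _ = 2 ^ i * (B * M * ε) := by
        rw [← Finset.sum_mul, ← Nat.cast_sum, Nat.sum_range_choose, Nat.cast_pow, Nat.cast_ofNat]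
    _ ≤ 2 ^ k * (B * M * ε) := by
        gcongr
        exact one_le_two

theorem exists_forall_exists_norm_iteratedFDeriv_cutoff_mul_le [FiniteDimensional ℝ E] {f : E → ℝ}
    (hf : ContDiff ℝ ∞ f) (hfc : HasCompactSupport f) {a : E} {k : ℕ}
    (ha : ∀ i ≤ k, iteratedFDeriv ℝ i f a = 0) :
    ∃ A, ∀ ε > 0, ε ≤ 1 → ∃ χ : E → ℝ, ContDiff ℝ ∞ χ ∧ χ =ᶠ[𝓝 a] 1 ∧
      tsupport χ ⊆ Metric.closedBall a ε ∧
      ∀ i ≤ k, ∀ x, ‖iteratedFDeriv ℝ i (fun y => χ y * f y) x‖ ≤ A * ε := by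
  obtain ⟨B, hB⟩ := exists_forall_exists_cutoff a k
  obtain ⟨M, hM⟩ := exists_forall_norm_iteratedFDeriv_le hf hfc (k + 1)
  have hM₀ : 0 ≤ M := (norm_nonneg _).trans (hM 0 (Nat.zero_le _) a)
  refine ⟨2 ^ k * (B * M), fun ε hε hε₁ => ?_⟩
  obtain ⟨χ, hχ, hχa, hsupp, hBχ⟩ := hB ε hε
  have hball : ∀ i ≤ k, ∀ x ∈ Metric.closedBall a ε,
      ‖iteratedFDeriv ℝ i (fun y => χ y * f y) x‖ ≤ 2 ^ k * (B * M * ε) := by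
    intro i hi x hx
    refine norm_iteratedFDeriv_mul_le_of_le hχ hf hε hε₁ (fun j hj => hBχ j hj x)
      (fun i n hin => ?_) hi
    have hxa : ‖x - a‖ ≤ ε := mem_closedBall_iff_norm.1 hx
    refine (norm_iteratedFDeriv_le_mul_pow hf (hM (k + 1) le_rfl) ha hin x).trans ?_
    gcongr
  have hnonneg : 0 ≤ 2 ^ k * (B * M * ε) :=
    (norm_nonneg _).trans (hball 0 k.zero_le a (Metric.mem_closedBall_self hε.le))
  refine ⟨χ, hχ, hχa, hsupp, fun i hi x => ?_⟩
  rw [mul_assoc]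
  by_cases hx : x ∈ tsupport fun y => χ y * f y
  · exact hball i hi x (hsupp (tsupport_mul_subset_left hx))
  · rwa [Function.notMem_support.1 fun h => hx (support_iteratedFDeriv_subset i h), norm_zero]

variable {Ω : Opens E}

theorem exists_norm_le_of_forall_norm_iteratedFDeriv_le (T : 𝓓'(Ω, F)) {K : Compacts E}
    (hK : (K : Set E) ⊆ Ω) : ∃ (k : ℕ) (C : ℝ), ∀ (φ : 𝓓(Ω, ℝ)) (A : ℝ), tsupport φ ⊆ K → 0 ≤ A →
      (∀ i ≤ k, ∀ x ∈ K, ‖iteratedFDeriv ℝ i φ x‖ ≤ A) → ‖T φ‖ ≤ C * A := by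
  let T' : 𝓓_{K}(E, ℝ) →L[ℝ] F :=
    (T : 𝓓(Ω, ℝ) →L[ℝ] F) ∘L TestFunction.ofSupportedInCLM ℝ hK
  obtain ⟨s, C, -, hC⟩ := Seminorm.bound_of_continuous
    (ContDiffMapSupportedIn.withSeminorms ℝ E ℝ ⊤ K)
    ((normSeminorm ℝ F).comp T'.toLinearMap) (continuous_norm.comp T'.continuous)
  refine ⟨s.sup id, C, fun φ A hφ hA h => ?_⟩
  let f : 𝓓_{K}(E, ℝ) := .of_support_subset φ.contDiff ((subset_tsupport _).trans hφ)
  have hTφ : ‖T φ‖ ≤ C * (s.sup (ContDiffMapSupportedIn.seminorm ℝ E ℝ ⊤ K)) f := hC f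
  refine hTφ.trans (mul_le_mul_of_nonneg_left ?_ C.2)
  refine Seminorm.finset_sup_apply_le hA fun i hi => ?_
  rw [ContDiffMapSupportedIn.seminorm_top_le_iff ℝ hA]
  exact fun x hx => h i (Finset.le_sup (f := id) hi) x hx

variable [FiniteDimensional ℝ E]

theorem exists_forall_eq_zero_of_iteratedFDeriv_eq_zero (T : 𝓓'(Ω, F)) {a : E} (ha : a ∈ Ω)
    (hT : ∀ φ : 𝓓(Ω, ℝ), a ∉ tsupport φ → T φ = 0) :
    ∃ k : ℕ, ∀ φ : 𝓓(Ω, ℝ), (∀ i ≤ k, iteratedFDeriv ℝ i φ a = 0) → T φ = 0 := by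
  obtain ⟨r, hr, hrΩ⟩ := Metric.nhds_basis_closedBall.mem_iff.1 (Ω.isOpen.mem_nhds ha)
  obtain ⟨k, C, hC⟩ := exists_norm_le_of_forall_norm_iteratedFDeriv_le T
    (K := ⟨Metric.closedBall a r, isCompact_closedBall a r⟩) hrΩ
  refine ⟨k, fun φ hφ => norm_le_zero_iff.1 ?_⟩
  obtain ⟨A, hA⟩ := exists_forall_exists_norm_iteratedFDeriv_cutoff_mul_le φ.contDiff
    φ.hasCompactSupport hφ
  have hbound : ∀ ε > 0, ε ≤ 1 → ε ≤ r → ‖T φ‖ ≤ C * (A * ε) := by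
    intro ε hε hε₁ hεr
    obtain ⟨χ, hχ, hχa, hsupp, hχφ⟩ := hA ε hε hε₁
    have hTφ : T φ = T (smoothMul hχ φ) := by
      rw [← sub_eq_zero, ← map_sub]
      refine hT _ (notMem_tsupport_iff_eventuallyEq.2 ?_)
      filter_upwards [hχa] with y hy
      rw [sub_apply, smoothMul_apply, hy, Pi.one_apply, one_mul, sub_self, Pi.zero_apply]
    rw [hTφ]
    exact hC _ _ (((tsupport_smoothMul_subset hχ φ).trans hsupp).trans
      (Metric.closedBall_subset_closedBall hεr)) ((norm_nonneg _).trans (hχφ 0 k.zero_le a))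
      fun i hi x _ => hχφ i hi x
  have hlim : Tendsto (fun ε => C * (A * ε)) (𝓝[>] 0) (𝓝 0) :=
    (Continuous.tendsto' (by fun_prop) _ _ (by simp)).mono_left nhdsWithin_le_nhds
  refine ge_of_tendsto hlim ?_
  filter_upwards [self_mem_nhdsWithin, nhdsWithin_le_nhds (Iic_mem_nhds one_pos),
    nhdsWithin_le_nhds (Iic_mem_nhds hr)] with ε hε hε₁ hεr using hbound ε hε hε₁ hεr

end FiniteOrder

section TestFunctionDerivatives

variable {E F : Type*} [NormedAddCommGroup E] [NormedSpace ℝ E] [NormedAddCommGroup F]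
  [NormedSpace ℝ F] {Ω : Opens E}

theorem testFunction_lineDeriv_apply (v : E) (φ : 𝓓(Ω, F)) (x : E) :
    (∂_{v} φ : 𝓓(Ω, F)) x = fderiv ℝ φ x v := by
  rw [TestFunction.lineDerivOp_eq_lineDerivCLM ℝ, TestFunction.lineDerivCLM_eq_fderivCLM,
    TestFunction.fderivCLM_apply_of_le φ (by simp)]

theorem integral_mul_fderiv_testFunction [FiniteDimensional ℝ E] [MeasurableSpace E]
    [BorelSpace E] (μ : Measure E) [μ.IsAddHaarMeasure] {f : E → ℝ} (hf : ContDiff ℝ 1 f)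
    (ψ : 𝓓(Ω, ℝ)) (v : E) :
    ∫ x, f x * fderiv ℝ ψ x v ∂μ = -∫ x, fderiv ℝ f x v * ψ x ∂μ := by
  have hψ : ContDiff ℝ 1 ψ := ψ.contDiff.of_le (by exact_mod_cast le_top)
  have hf' : Continuous fun x => fderiv ℝ f x v :=
    (hf.continuous_fderiv one_ne_zero).clm_apply continuous_const
  have hψ' : Continuous fun x => fderiv ℝ ψ x v :=
    (hψ.continuous_fderiv one_ne_zero).clm_apply continuous_const
  have hψc := ψ.hasCompactSupport
  exact integral_mul_fderiv_eq_neg_fderiv_mul_of_integrable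
    ((hf'.mul hψ.continuous).integrable_of_hasCompactSupport hψc.mul_left)
    ((hf.continuous.mul hψ').integrable_of_hasCompactSupport
      (hψc.fderiv_apply (𝕜 := ℝ) v).mul_left)
    ((hf.continuous.mul hψ.continuous).integrable_of_hasCompactSupport hψc.mul_left)
    (fun x _ => hf.differentiable one_ne_zero x) fun x _ => hψ.differentiable one_ne_zero x

end TestFunctionDerivatives

section EulerEigenvalues

variable {d : ℕ} {𝕜 : Type*} [RCLike 𝕜] {Ω : Opens (Fin d → ℝ)}

theorem fderiv_prod_pow_single_mul (α : Fin d →₀ ℕ) (j : Fin d) (x : Fin d → ℝ) :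
    fderiv ℝ (fun y : Fin d → ℝ => ∏ i, y i ^ α i) x (Pi.single j 1) * x j =
      α j * ∏ i, x i ^ α i := by
  have h (i : Fin d) : HasFDerivAt (fun y : Fin d → ℝ => y i ^ α i) _ x :=
    (hasFDerivAt_apply (𝕜 := ℝ) i x).pow (α i)
  have hpow : α j * x j ^ (α j - 1) * x j = α j * x j ^ α j := by
    rcases eq_or_ne (α j) 0 with h0 | h0
    · simp [h0]
    · rw [mul_assoc, pow_sub_one_mul h0]
  rw [(HasFDerivAt.finsetProd fun i _ => h i).fderiv, sum_apply,
    Finset.sum_eq_single j (fun i _ hij => by simp [Pi.single_eq_of_ne hij]) (by simp),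
    ← Finset.mul_prod_erase _ _ (Finset.mem_univ j), ← mul_assoc, ← hpow]
  simp only [nsmul_eq_mul, smul_apply, ContinuousLinearMap.proj_apply, Pi.single_eq_same,
    smul_eq_mul, mul_one]
  ring

theorem monomialDist_apply_eq_ofReal_integral (α : Fin d →₀ ℕ) (φ : 𝓓(Ω, ℝ)) :
    monomialDist 𝕜 Ω α φ = ((∫ x, (∏ j, x j ^ α j) * φ x : ℝ) : 𝕜) := by
  rw [monomialDist_apply_eq_integral_smul, ← integral_ofReal]
  simp [RCLike.real_smul_eq_coe_mul]

theorem theta_monomialDist (j : Fin d) (α : Fin d →₀ ℕ) :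
    theta 𝕜 Ω j (monomialDist 𝕜 Ω α) = (α j : 𝕜) • monomialDist 𝕜 Ω α := by
  ext φ
  have hf : ContDiff ℝ 1 fun x : Fin d → ℝ => ∏ i, x i ^ α i := by fun_prop
  have key : -∫ x, (∏ i, x i ^ α i) * fderiv ℝ (coordMulTest Ω j φ) x (Pi.single j 1) =
      α j * ∫ x, (∏ i, x i ^ α i) * φ x := by
    rw [integral_mul_fderiv_testFunction volume hf, neg_neg, ← integral_const_mul]
    simp only [← mul_assoc, ← fderiv_prod_pow_single_mul, coordMulTest_apply]
    exact integral_congr_ae (.of_forall fun x => by ring)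
  calc theta 𝕜 Ω j (monomialDist 𝕜 Ω α) φ
    _ = ((-∫ x, (∏ i, x i ^ α i) *
          fderiv ℝ (coordMulTest Ω j φ) x (Pi.single j 1) : ℝ) : 𝕜) := by
        simp only [theta_apply, monomialDist_apply_eq_ofReal_integral,
          testFunction_lineDeriv_apply, RCLike.ofReal_neg]
    _ = α j * monomialDist 𝕜 Ω α φ := by
        rw [key, monomialDist_apply_eq_ofReal_integral, RCLike.ofReal_mul, RCLike.ofReal_natCast]

theorem pow_apply_eq_smul {R V : Type*} [CommSemiring R] [AddCommMonoid V] [Module R V]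
    [TopologicalSpace V] {A : V →L[R] V} {v : V} {m : R} (h : A v = m • v) (n : ℕ) :
    (A ^ n) v = m ^ n • v := by
  induction n with
  | zero => simp
  | succ n ih => rw [pow_succ, mul_apply_eq_comp, h, map_smul, ih, smul_smul, pow_succ']

theorem prod_ofFn_apply_eq_smul {R V : Type*} [CommSemiring R] [AddCommMonoid V] [Module R V]
    [TopologicalSpace V] {n : ℕ} {A : Fin n → V →L[R] V} {v : V} {m : Fin n → R}
    (h : ∀ j, A j v = m j • v) : (List.ofFn A).prod v = (∏ j, m j) • v := by
  induction n with
  | zero => simp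
  | succ n ih =>
    rw [List.ofFn_succ, List.prod_cons, mul_apply_eq_comp, ih fun j => h j.succ,
      map_smul, h, smul_smul, Fin.prod_univ_succ, mul_comm]

theorem thetaPow_monomialDist (α β : Fin d →₀ ℕ) :
    thetaPow 𝕜 Ω α (monomialDist 𝕜 Ω β) = (∏ j, (β j : 𝕜) ^ α j) • monomialDist 𝕜 Ω β :=
  prod_ofFn_apply_eq_smul fun j => pow_apply_eq_smul (theta_monomialDist j β) (α j)

theorem sum_smul_apply_eq_smul {R V ι : Type*} [CommSemiring R] [AddCommMonoid V] [Module R V]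
    [TopologicalSpace V] [ContinuousAdd V] [ContinuousConstSMul R V] {A : ι → V →L[R] V} {v : V}
    {m : ι → R} (h : ∀ i, A i v = m i • v) (s : Finset ι) (c : ι → R) :
    (∑ i ∈ s, c i • A i) v = (∑ i ∈ s, c i * m i) • v := by
  simp [h, smul_smul, Finset.sum_smul]

theorem polyTheta_monomialDist (P : MvPolynomial (Fin d) 𝕜) (β : Fin d →₀ ℕ) :
    polyTheta Ω P (monomialDist 𝕜 Ω β) = P.eval (fun j => (β j : 𝕜)) • monomialDist 𝕜 Ω β := by
  rw [MvPolynomial.eval_eq']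
  exact sum_smul_apply_eq_smul (thetaPow_monomialDist · β) P.support P.coeff

theorem isDiagonal_polyTheta (P : MvPolynomial (Fin d) 𝕜) : IsDiagonal (polyTheta Ω P) :=
  fun β => ⟨_, polyTheta_monomialDist P β⟩

theorem polyTheta_sum_monomial {ι : Type*} (s : Finset ι) (α : ι → Fin d →₀ ℕ) (c : ι → 𝕜) :
    polyTheta Ω (∑ i ∈ s, MvPolynomial.monomial (α i) (c i)) =
      ∑ i ∈ s, c i • thetaPow 𝕜 Ω (α i) := by
  refine clm_ext_monomialDist fun β => ?_
  rw [polyTheta_monomialDist, sum_smul_apply_eq_smul (fun i => thetaPow_monomialDist (α i) β),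
    map_sum]
  simp [MvPolynomial.eval_monomial, Finsupp.prod_fintype]

theorem thetaPow_add_single (α : Fin d →₀ ℕ) (j : Fin d) :
    thetaPow 𝕜 Ω (α + Finsupp.single j 1) = theta 𝕜 Ω j * thetaPow 𝕜 Ω α := by
  classical
  refine clm_ext_monomialDist fun β => ?_
  rw [mul_apply_eq_comp, thetaPow_monomialDist, thetaPow_monomialDist, map_smul,
    theta_monomialDist, smul_smul]
  congr 1
  simp only [Finsupp.add_apply, pow_add, Finset.prod_mul_distrib, Finsupp.single_apply]
  simp

end EulerEigenvalues

section Jets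

variable {E F : Type*} [NormedAddCommGroup E] [NormedSpace ℝ E] [NormedAddCommGroup F]
  [NormedSpace ℝ F]

theorem iteratedFDeriv_mul_eq_zero {f g : E → ℝ} {s : Set E} (hs : IsOpen s) {a : E} (ha : a ∈ s)
    (hf : ContDiffOn ℝ ∞ f s) (hg : ContDiffOn ℝ ∞ g s) {k : ℕ}
    (h : ∀ i ≤ k, iteratedFDeriv ℝ i g a = 0) :
    ∀ i ≤ k, iteratedFDeriv ℝ i (fun x => f x * g x) a = 0 := by
  intro i hi
  have hmul := norm_iteratedFDerivWithin_mul_le hf hg hs.uniqueDiffOn ha (n := i)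
    (by exact_mod_cast le_top)
  simp only [iteratedFDerivWithin_of_isOpen _ hs ha] at hmul
  refine norm_le_zero_iff.1 (hmul.trans_eq (Finset.sum_eq_zero fun l _ => ?_))
  rw [h (i - l) (by omega), norm_zero, mul_zero]

theorem iteratedFDeriv_succ_eq_zero {ι : Type*} [Fintype ι] [DecidableEq ι] {f : (ι → ℝ) → F}
    (hf : ContDiff ℝ ∞ f) {a : ι → ℝ} {i : ℕ}
    (h : ∀ j, iteratedFDeriv ℝ i (fun x => fderiv ℝ f x (Pi.single j 1)) a = 0) :
    iteratedFDeriv ℝ (i + 1) f a = 0 := by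
  ext m
  rw [iteratedFDeriv_succ_apply_right]
  suffices hlin : iteratedFDeriv ℝ i (fderiv ℝ f) a (Fin.init m) = 0 by simp [hlin]
  have hf' : ContDiffAt ℝ ∞ (fderiv ℝ f) a := (hf.fderiv_right (m := ∞) (by simp)).contDiffAt
  refine ContinuousLinearMap.coe_injective ((Pi.basisFun ℝ ι).ext fun j => ?_)
  have hj := (ContinuousLinearMap.apply ℝ F (Pi.single j 1 : ι → ℝ)).iteratedFDeriv_comp_left
    hf' (i := i) (by exact_mod_cast le_top)
  simpa using congr($(hj.symm.trans (h j)) (Fin.init m))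

theorem iteratedFDeriv_succ_eq_zero_of_coord_mul_fderiv {ι : Type*} [Fintype ι] [DecidableEq ι]
    {f : (ι → ℝ) → ℝ} (hf : ContDiff ℝ ∞ f) {a : ι → ℝ} (ha : ∀ j, a j ≠ 0) {k : ℕ}
    (h : ∀ j, ∀ i ≤ k, iteratedFDeriv ℝ i (fun x => x j * fderiv ℝ f x (Pi.single j 1)) a = 0) :
    ∀ i ≤ k, iteratedFDeriv ℝ (i + 1) f a = 0 := by
  refine fun i hi => iteratedFDeriv_succ_eq_zero hf fun j => ?_
  let s : Set (ι → ℝ) := {x | x j ≠ 0}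
  have hs : IsOpen s := isOpen_ne_fun (continuous_apply j) continuous_const
  have hinv : ContDiffOn ℝ ∞ (fun x : ι → ℝ => (x j)⁻¹) s :=
    (contDiff_apply ℝ ℝ j).contDiffOn.inv fun x hx => hx
  have hf' : ContDiff ℝ ∞ fun x => fderiv ℝ f x (Pi.single j 1) :=
    (hf.fderiv_right (m := ∞) (by simp)).clm_apply contDiff_const
  have hdiv : (fun x => fderiv ℝ f x (Pi.single j 1)) =ᶠ[𝓝 a]
      fun x => (x j)⁻¹ * (x j * fderiv ℝ f x (Pi.single j 1)) := by
    filter_upwards [hs.mem_nhds (ha j)] with x hx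
    rw [inv_mul_cancel_left₀ hx]
  rw [(hdiv.iteratedFDeriv ℝ i).eq_of_nhds]
  exact iteratedFDeriv_mul_eq_zero hs (ha j) hinv ((contDiff_apply ℝ ℝ j).mul hf').contDiffOn
    (h j) i hi

variable {d : ℕ} {Ω : Opens (Fin d → ℝ)}

theorem lineDeriv_coordMulTest_apply (j : Fin d) (φ : 𝓓(Ω, ℝ)) (x : Fin d → ℝ) :
    (∂_{(Pi.single j 1 : Fin d → ℝ)} (coordMulTest Ω j φ) : 𝓓(Ω, ℝ)) x =
      x j * fderiv ℝ φ x (Pi.single j 1) + φ x := by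
  have hφ : HasFDerivAt φ _ x := (φ.contDiff.differentiable (by simp) x).hasFDerivAt
  have hmul : HasFDerivAt (coordMulTest Ω j φ) _ x := hφ.mul (hasFDerivAt_apply (𝕜 := ℝ) j x)
  rw [testFunction_lineDeriv_apply, hmul.fderiv]
  simp [add_comm]

theorem iteratedFDeriv_eq_zero_of_thetaPow_dirac_eq_zero {a : Fin d → ℝ} (ha : ∀ j, a j ≠ 0)
    {φ : 𝓓(Ω, ℝ)} {k : ℕ}
    (h : ∀ α : Fin d →₀ ℕ, α.degree ≤ k → thetaPow ℝ Ω α (dirac ℝ Ω a) φ = 0) :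
    ∀ i ≤ k, iteratedFDeriv ℝ i φ a = 0 := by
  induction k generalizing φ with
  | zero =>
    intro i hi
    obtain rfl : i = 0 := by omega
    have h0 : dirac ℝ Ω a φ = 0 := by simpa [thetaPow] using h 0 (by simp)
    ext m
    simpa [dirac_apply] using h0
  | succ k ih =>
    have hφ := ih fun α hα => h α (by omega)
    suffices hsucc : ∀ i ≤ k, iteratedFDeriv ℝ (i + 1) φ a = 0 by
      rintro (_ | i) hi
      exacts [hφ 0 (by omega), hsucc i (by omega)]
    refine iteratedFDeriv_succ_eq_zero_of_coord_mul_fderiv φ.contDiff ha fun j i hi => ?_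
    let ψ : 𝓓(Ω, ℝ) := ∂_{(Pi.single j 1 : Fin d → ℝ)} (coordMulTest Ω j φ)
    have hψ : iteratedFDeriv ℝ i ψ a = 0 := by
      refine ih (fun α hα => ?_) i hi
      have := h (α + Finsupp.single j 1) (by simpa using hα)
      rwa [thetaPow_add_single, mul_apply_eq_comp, theta_apply, neg_eq_zero] at this
    have hsub : (fun x => x j * fderiv ℝ φ x (Pi.single j 1)) = ψ - φ := by
      ext x
      simp [ψ, lineDeriv_coordMulTest_apply]
    rw [hsub, iteratedFDeriv_sub_apply (ψ.contDiff.of_le (by exact_mod_cast le_top)).contDiffAt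
      (φ.contDiff.of_le (by exact_mod_cast le_top)).contDiffAt, hψ, hφ i hi, sub_zero]

end Jets

section PointSupport

theorem exists_forall_eq_sum_smul {ι K V W : Type*} [Fintype ι] [Field K] [AddCommGroup V]
    [Module K V] [AddCommGroup W] [Module K W] (ℓ : ι → V →ₗ[K] K) (T : V →ₗ[K] W)
    (h : ∀ v, (∀ i, ℓ i v = 0) → T v = 0) : ∃ w : ι → W, ∀ v, T v = ∑ i, ℓ i v • w i := by
  classical
  let Φ : V →ₗ[K] ι → K := LinearMap.pi ℓ
  obtain ⟨σ, hσ⟩ := Φ.rangeRestrict.exists_rightInverse_of_surjective Φ.range_rangeRestrict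
  obtain ⟨g, hg⟩ := (T ∘ₗ σ).exists_extend
  have hfactor : ∀ v, T v = g (Φ v) := by
    intro v
    have hσv : Φ.rangeRestrict (σ (Φ.rangeRestrict v)) = Φ.rangeRestrict v := congr($hσ _)
    have hker : T (v - σ (Φ.rangeRestrict v)) = 0 := by
      refine h _ fun i => ?_
      have := congr_fun (congrArg Subtype.val hσv) i
      rw [map_sub, sub_eq_zero]
      exact this.symm
    rw [map_sub, sub_eq_zero] at hker
    exact hker.trans congr($hg (Φ.rangeRestrict v)).symm
  exact ⟨_, fun v => (hfactor v).trans (g.pi_apply_eq_sum_univ (Φ v))⟩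

theorem semiconj_prod_ofFn {R S V W : Type*} [Semiring R] [AddCommMonoid V] [Module R V]
    [TopologicalSpace V] [Semiring S] [AddCommMonoid W] [Module S W] [TopologicalSpace W]
    {f : V → W} {n : ℕ} {A : Fin n → V →L[R] V} {B : Fin n → W →L[S] W}
    (h : ∀ j, Function.Semiconj f (A j) (B j)) :
    Function.Semiconj f (List.ofFn A).prod (List.ofFn B).prod := by
  induction n with
  | zero => simpa using Function.Semiconj.id_right
  | succ n ih =>
    simp only [List.ofFn_succ, List.prod_cons]
    exact (h 0).comp_right (ih fun j => h j.succ)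

variable {d : ℕ} {𝕜 : Type*} [RCLike 𝕜] {Ω : Opens (Fin d → ℝ)}

theorem thetaPow_dirac_apply (α : Fin d →₀ ℕ) (a : Fin d → ℝ) (φ : 𝓓(Ω, ℝ)) :
    thetaPow 𝕜 Ω α (dirac 𝕜 Ω a) φ = (thetaPow ℝ Ω α (dirac ℝ Ω a) φ : ℝ) := by
  let f : 𝓓'(Ω, ℝ) → 𝓓'(Ω, 𝕜) := Distribution.mapCLM RCLike.ofRealCLM
  have htheta (j : Fin d) : Function.Semiconj f (theta ℝ Ω j) (theta 𝕜 Ω j) := fun S => by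
    ext φ
    simp [f, theta_apply]
  have hpow : Function.Semiconj f (thetaPow ℝ Ω α) (thetaPow 𝕜 Ω α) :=
    semiconj_prod_ofFn fun j => by
      simpa only [FunLike.coe_pow_eq_iterate] using (htheta j).iterate_right (α j)
  exact congr($((hpow (dirac ℝ Ω a)).symm) φ)

theorem exists_eq_polyTheta_dirac (T : 𝓓'(Ω, 𝕜)) {a : Fin d → ℝ} (ha : a ∈ Ω) (ha₀ : ∀ j, a j ≠ 0)
    (hT : ∀ φ : 𝓓(Ω, ℝ), a ∉ tsupport φ → T φ = 0) :
    ∃ P : MvPolynomial (Fin d) 𝕜, T = polyTheta Ω P (dirac 𝕜 Ω a) := by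
  obtain ⟨k, hk⟩ := exists_forall_eq_zero_of_iteratedFDeriv_eq_zero T ha hT
  let s : Finset (Fin d →₀ ℕ) := (Finsupp.finite_of_degree_le k).toFinset
  obtain ⟨c, hc⟩ := exists_forall_eq_sum_smul
    (fun α : s => (thetaPow ℝ Ω α (dirac ℝ Ω a) : 𝓓(Ω, ℝ) →L[ℝ] ℝ).toLinearMap)
    (T : 𝓓(Ω, ℝ) →L[ℝ] 𝕜).toLinearMap fun φ hφ => hk φ <|
      iteratedFDeriv_eq_zero_of_thetaPow_dirac_eq_zero ha₀ fun α hα => hφ ⟨α, by simpa [s] using hα⟩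
  refine ⟨∑ α : s, MvPolynomial.monomial α.1 (c α), ?_⟩
  ext φ
  calc T φ
    _ = ∑ α : s, c α * thetaPow 𝕜 Ω α (dirac 𝕜 Ω a) φ := by
        refine (hc φ).trans (Finset.sum_congr rfl fun α _ => ?_)
        rw [thetaPow_dirac_apply, RCLike.real_smul_eq_coe_mul, mul_comm]
        rfl
    _ = polyTheta Ω (∑ α : s, MvPolynomial.monomial α.1 (c α)) (dirac 𝕜 Ω a) φ := by
        simp only [polyTheta_sum_monomial, sum_apply]
        rfl

end PointSupport

end Hadamard

end

theorem theorem3p7_general {𝕜 : Type*} [RCLike 𝕜] {d : ℕ} (Ω : Opens (Fin d → ℝ))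
    (hne : (Ω : Set (Fin d → ℝ)).Nonempty) (hΩ₀ : ∀ x ∈ Ω, ∀ j, x j ≠ 0)
    (hΩ : Hadamard.IsDilationRigid (Ω : Set (Fin d → ℝ)))
    (L : 𝓓'(Ω, 𝕜) →L[𝕜] 𝓓'(Ω, 𝕜)) (hL : Hadamard.IsDiagonal L) : Hadamard.IsEulerOperator L := by
  obtain ⟨a, ha⟩ := hne
  obtain ⟨P, hP⟩ := Hadamard.exists_eq_polyTheta_dirac (L (Hadamard.dirac 𝕜 Ω a)) ha (hΩ₀ a ha)
    fun φ hφ => hL.apply_dirac_eq_zero_of_notMem_tsupport hΩ hΩ₀ ha hφ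
  exact ⟨P, hL.eq_of_apply_dirac_eq (Hadamard.isDiagonal_polyTheta P) hΩ hΩ₀ ha hP⟩

theorem theorem3p7 {𝕜 : Type*} [RCLike 𝕜] {d : ℕ} (Ω : TopologicalSpace.Opens (Fin d → ℝ))
    (hne : (Ω : Set (Fin d → ℝ)).Nonempty)
    (hΩ : Hadamard.RelativelyCompactIn (Ω : Set (Fin d → ℝ)) (Hadamard.posOrthant d))
    (L : 𝓓'(Ω, 𝕜) →L[𝕜] 𝓓'(Ω, 𝕜)) (hL : Hadamard.IsHadamardOperator L) :
    Hadamard.IsEulerOperator L :=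
  theorem3p7_general Ω hne (fun _ hx j => (hΩ.2 (subset_closure hx) j).ne')
    (Hadamard.isDilationRigid_of_relativelyCompactIn_posOrthant hne hΩ) L hL.isDiagonal
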